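/- Let $(V,Y,\mathbf 1,\omega)$ be a vertex operator algebra over $\mathbb C$ and let $g$ be an automorphism of $V$ of finite order $T$; put $V^r=\{v\in V: gv=e^{2\pi i r/T}v\}$ for $0\le r\le T-1$. A weak $g$-twisted $V$-module is a complex vector space $M$ with a linear map $v\mapsto Y_M(v,z)=\sum_{n\in\mathbb Q}v_nz^{-n-1}$ ($v_n\in\operatorname{End}M$) such that, for all $0\le r\le T-1$, $u\in V^r$, $v\in V$ and $w\in M$: $u_n=0$ unless $n\in\frac rT+\mathbb Z$; $v_lw=0$ for $l\gg0$; $Y_M(\mathbf 1,z)=1$; and the twisted Jacobi identity holds: $$z_0^{-1}\delta\Big(\frac{z_1-z_2}{z_0}\Big)Y_M(u,z_1)Y_M(v,z_2)-z_0^{-1}\delta\Big(\frac{z_2-z_1}{-z_0}\Big)Y_M(v,z_2)Y_M(u,z_1)=z_2^{-1}\Big(\frac{z_1-z_0}{z_2}\Big)^{-r/T}\delta\Big(\frac{z_1-z_0}{z_2}\Big)Y_M(Y(u,z_0)v,z_2).$$ A $g$-twisted $V$-module is a weak $g$-twisted $V$-module $M$ which is the direct sum of the eigenspaces $M_\lambda$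 ($\lambda\in\mathbb C$) of $L(0)=\omega_1$, where every $M_\lambda$ is finite-dimensional and, for each fixed $\lambda$, $M_{\lambda+n/T}=0$ for all sufficiently small integers $n$. It is simple if it is nonzero and $0$ and $M$ are its only subspaces stable under all $v_n$ (submodules). Two such modules are equivalent if there is a linear bijection between them commuting with all $v_n$. **Proposition.** Suppose that there are only finitely many simple $g$-twisted $V$-modules up to equivalence. Then every $g$-twisted $V$-module $M$ has a finite composition series $0=M^0\subseteq M^1\subseteq\cdots\subseteq M^k=M$ of submodules such that each factor $M^{i+1}/M^i$ is a simple $g$-twisted $V$-module. -/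

import Mathlib

universe u v

noncomputable section

open scoped VertexOperator

/-- A vertex operator algebra structure on the complex vector space `V`, in the usual sense of
Frenkel, Lepowsky and Meurman. A vertex operator `Y u` is a field `Y(u, z) = ∑ u_n z^(-n-1)`, and
`(Y u)[[n]]` is its mode `u_n`; the truncation condition `u_n w = 0` for `n ≫ 0` is part of
Mathlib's type `VertexOperator` (Laurent series in `z` after applying the field to a vector). -/
structure VertexOperatorAlgebra (V : Type u) [AddCommGroup V] [Module ℂ V] where
  /-- The state-field correspondence `u ↦ Y(u, z)`. -/
  Y : V →ₗ[ℂ] VertexOperator ℂ V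
  /-- The vacuum vector. -/
  vac : V
  /-- The Virasoro (conformal) vector. -/
  ω : V
  /-- The rank (central charge). -/
  rank : ℂ
  /-- The homogeneous subspaces `V_n`. -/
  gr : ℤ → Submodule ℂ V
  gr_isInternal : DirectSum.IsInternal gr
  gr_finite : ∀ n, FiniteDimensional ℂ (gr n)
  gr_bounded : ∃ N : ℤ, ∀ n < N, gr n = ⊥
  vac_mem : vac ∈ gr 0
  ω_mem : ω ∈ gr 2
  /-- `Y(1, z) = 1`. -/
  vacuum : ∀ (n : ℤ) (w : V), ((Y vac)[[n]]) w = if n = -1 then w else 0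
  /-- `Y(v, z) 1` has no negative powers of `z`, and its constant term is `v`. -/
  creation : ∀ v : V, (∀ n : ℤ, 0 ≤ n → ((Y v)[[n]]) vac = 0) ∧ ((Y v)[[-1]]) vac = v
  /-- The Jacobi identity, applied to a vector `w`: the coefficient of
  `z₀^(-l-1) z₁^(-m-1) z₂^(-n-1)`. All sums are finite by truncation. -/
  jacobi : ∀ (u v w : V) (l m n : ℤ),
    (∑ᶠ i : ℕ, ((-1 : ℂ) ^ i * (Ring.choose l i : ℤ)) •
        ((Y u)[[m + l - i]]) (((Y v)[[n + i]]) w)) -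
      (∑ᶠ i : ℕ, ((-1 : ℂ) ^ (l + i) * (Ring.choose l i : ℤ)) •
        ((Y v)[[n + l - i]]) (((Y u)[[m + i]]) w)) =
    ∑ᶠ i : ℕ, ((Ring.choose m i : ℤ) : ℂ) • ((Y (((Y u)[[l + i]]) v))[[m + n - i]]) w
  /-- The Virasoro relations for `L(n) = ω_(n+1)`. -/
  virasoro : ∀ (m n : ℤ) (w : V),
    ((Y ω)[[m + 1]]) (((Y ω)[[n + 1]]) w) - ((Y ω)[[n + 1]]) (((Y ω)[[m + 1]]) w) =
      ((m : ℂ) - n) • ((Y ω)[[m + n + 1]]) w +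
        (if m + n = 0 then ((m : ℂ) ^ 3 - m) / 12 * rank else 0) • w
  /-- `L(0)` acts on `V_n` as multiplication by `n`. -/
  L_zero : ∀ (n : ℤ), ∀ w ∈ gr n, ((Y ω)[[1]]) w = (n : ℂ) • w
  /-- `Y(L(-1)v, z) = d/dz Y(v, z)`. -/
  L_neg_one : ∀ (v : V) (n : ℤ) (w : V),
    ((Y (((Y ω)[[0]]) v))[[n]]) w = (-(n : ℂ)) • ((Y v)[[n - 1]]) w

section Operators

variable {V : Type u} [AddCommGroup V] [Module ℂ V]
variable {M : Type v} [AddCommGroup M] [Module ℂ M]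

/-- The space `V^r = {v | g v = exp(2πir/T) v}`, where `T` is the order of `g`. -/
def twistEigenspace (g : V ≃ₗ[ℂ] V) (r : ℕ) : Submodule ℂ V :=
  Module.End.eigenspace (g : V →ₗ[ℂ] V)
    (Complex.exp (2 * Real.pi * Complex.I * r / orderOf g))

/-- The subspace `W` of `M` is stable under all operators `v_n`. Here and below, a linear map
`v ↦ Y_M(v, z) = ∑ v_n z^(-n-1)` with `n` ranging over `ℚ` is given by `YM v n = v_n`. -/
def IsStableUnder (YM : V →ₗ[ℂ] (ℚ → Module.End ℂ M)) (W : Submodule ℂ M) : Prop :=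
  ∀ (v : V) (n : ℚ), ∀ w ∈ W, YM v n w ∈ W

/-- The operators `v_n` restricted to a stable subspace. -/
def restrictOperators (YM : V →ₗ[ℂ] (ℚ → Module.End ℂ M)) (W : Submodule ℂ M)
    (hW : IsStableUnder YM W) : V →ₗ[ℂ] (ℚ → Module.End ℂ W) where
  toFun v n := (YM v n).restrict (hW v n)
  map_add' a b := by
    ext n w
    simp
  map_smul' c a := by
    ext n w
    simp

/-- The operators `v_n` induced on the quotient by a stable subspace. -/
def quotientOperators (YM : V →ₗ[ℂ] (ℚ → Module.End ℂ M)) (W : Submodule ℂ M)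
    (hW : IsStableUnder YM W) : V →ₗ[ℂ] (ℚ → Module.End ℂ (M ⧸ W)) where
  toFun v n := W.mapQ W (YM v n) (hW v n)
  map_add' a b := by
    ext n w
    simp
  map_smul' c a := by
    ext n w
    simp

theorem IsStableUnder.submoduleOf {YM : V →ₗ[ℂ] (ℚ → Module.End ℂ M)} {P Q : Submodule ℂ M}
    (hP : IsStableUnder YM P) (hQ : IsStableUnder YM Q) :
    IsStableUnder (restrictOperators YM Q hQ) (P.submoduleOf Q) :=
  fun v n w hw => hP v n w hw

/-- The operators `v_n` induced on the factor `Q / (P ∩ Q)` of two stable subspaces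
(which is `Q / P` when `P ≤ Q`). -/
def factorOperators (YM : V →ₗ[ℂ] (ℚ → Module.End ℂ M)) (P Q : Submodule ℂ M)
    (hP : IsStableUnder YM P) (hQ : IsStableUnder YM Q) :
    V →ₗ[ℂ] (ℚ → Module.End ℂ (Q ⧸ P.submoduleOf Q)) :=
  quotientOperators (restrictOperators YM Q hQ) (P.submoduleOf Q) (hP.submoduleOf hQ)

end Operators

namespace VertexOperatorAlgebra

variable {V : Type u} [AddCommGroup V] [Module ℂ V]

/-- `g` is an automorphism of the vertex operator algebra: `g Y(u, z) g⁻¹ = Y(gu, z)`, and `g`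
fixes the vacuum and the Virasoro vector. -/
structure IsAutomorphism (A : VertexOperatorAlgebra V) (g : V ≃ₗ[ℂ] V) : Prop where
  map_vac : g A.vac = A.vac
  map_ω : g A.ω = A.ω
  map_mode : ∀ (u : V) (n : ℤ) (w : V), g (((A.Y u)[[n]]) w) = ((A.Y (g u))[[n]]) (g w)

section Modules

variable {M : Type v} [AddCommGroup M] [Module ℂ M]

/-- `(M, YM)` is a weak `g`-twisted `V`-module; `T` is the order of `g`. -/
structure IsWeakTwistedModule (A : VertexOperatorAlgebra V) (g : V ≃ₗ[ℂ] V)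
    (YM : V →ₗ[ℂ] (ℚ → Module.End ℂ M)) : Prop where
  /-- For `u ∈ V^r`, only the exponents `n ∈ r/T + ℤ` occur. -/
  mode_eq_zero : ∀ r < orderOf g, ∀ u ∈ twistEigenspace g r, ∀ n : ℚ,
    (∀ k : ℤ, n ≠ (r : ℚ) / orderOf g + k) → YM u n = 0
  /-- `v_l w = 0` for `l ≫ 0`. -/
  truncation : ∀ (v : V) (w : M), ∃ N : ℚ, ∀ l : ℚ, N ≤ l → YM v l w = 0
  /-- `Y_M(1, z) = 1`. -/
  vacuum : ∀ n : ℚ, YM A.vac n = if n = -1 then 1 else 0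
  /-- The twisted Jacobi identity for `u ∈ V^r`, applied to a vector `w`: the coefficient of
  `z₀^(-l-1) z₁^(-m-1) z₂^(-n-1)`, where `l ∈ ℤ`, `m ∈ r/T + ℤ`, `n ∈ ℚ` (both sides of the
  identity have no other powers of `z₀` and `z₁`). The coefficient on the right arises from
  `z₂⁻¹ ((z₁ - z₀)/z₂)^(-r/T) δ((z₁ - z₀)/z₂)`, since
  `(-1)^i * choose (i - m - 1) i = choose m i`. All sums are finite by truncation. -/
  jacobi : ∀ r < orderOf g, ∀ u ∈ twistEigenspace g r, ∀ (v : V) (w : M) (l : ℤ) (m n : ℚ),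
    (∃ k : ℤ, m = (r : ℚ) / orderOf g + k) →
    (∑ᶠ i : ℕ, ((-1 : ℂ) ^ i * (Ring.choose l i : ℤ)) •
        YM u (m + l - i) (YM v (n + i) w)) -
      (∑ᶠ i : ℕ, ((-1 : ℂ) ^ (l + i) * (Ring.choose l i : ℤ)) •
        YM v (n + l - i) (YM u (m + i) w)) =
    ∑ᶠ i : ℕ, ((Ring.choose m i : ℚ) : ℂ) • YM (((A.Y u)[[l + i]]) v) (m + n - i) w

/-- The space `M_a` of vectors of weight `a`: the `a`-eigenspace of `L(0) = ω_1` on `M`. -/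
def weightSpace (A : VertexOperatorAlgebra V) (YM : V →ₗ[ℂ] (ℚ → Module.End ℂ M)) (a : ℂ) :
    Submodule ℂ M :=
  Module.End.eigenspace (YM A.ω 1) a

/-- `(M, YM)` is a (an ordinary) `g`-twisted `V`-module: a weak one, graded by the eigenspaces of
`L(0)`, which are finite-dimensional, and with `M_(n/T + a) = 0` for all small enough
integers `n`, for each fixed `a`. -/
structure IsTwistedModule (A : VertexOperatorAlgebra V) (g : V ≃ₗ[ℂ] V)
    (YM : V →ₗ[ℂ] (ℚ → Module.End ℂ M)) : Prop extends A.IsWeakTwistedModule g YM where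
  isInternal : DirectSum.IsInternal (A.weightSpace YM)
  finite_weightSpace : ∀ a : ℂ, FiniteDimensional ℂ (A.weightSpace YM a)
  bounded_below : ∀ a : ℂ, ∃ N : ℤ, ∀ n < N, A.weightSpace YM ((n : ℂ) / orderOf g + a) = ⊥

/-- `(M, YM)` is a simple `g`-twisted `V`-module: it is nonzero, and `0` and `M` are its only
submodules. -/
structure IsSimpleTwistedModule (A : VertexOperatorAlgebra V) (g : V ≃ₗ[ℂ] V)
    (YM : V →ₗ[ℂ] (ℚ → Module.End ℂ M)) : Prop extends A.IsTwistedModule g YM where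
  nontrivial : Nontrivial M
  eq_bot_or_eq_top : ∀ W : Submodule ℂ M, IsStableUnder YM W → W = ⊥ ∨ W = ⊤

/-- `M` has a finite composition series `0 = F_0 ⊆ F_1 ⊆ ⋯ ⊆ F_n = M` of submodules, each
factor `F_(i+1) / F_i` of which is a simple `g`-twisted `V`-module. -/
def HasFiniteCompositionSeries (A : VertexOperatorAlgebra V) (g : V ≃ₗ[ℂ] V)
    (YM : V →ₗ[ℂ] (ℚ → Module.End ℂ M)) : Prop :=
  ∃ (n : ℕ) (F : Fin (n + 1) → Submodule ℂ M) (hF : ∀ i, IsStableUnder YM (F i)),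
    F 0 = ⊥ ∧ F (Fin.last n) = ⊤ ∧
      ∀ i : Fin n, F i.castSucc ≤ F i.succ ∧
        A.IsSimpleTwistedModule g
          (factorOperators YM (F i.castSucc) (F i.succ) (hF i.castSucc) (hF i.succ))

end Modules

/-- A simple `g`-twisted `V`-module, with its underlying space. -/
structure SimpleTwistedModule (A : VertexOperatorAlgebra V) (g : V ≃ₗ[ℂ] V) where
  /-- The underlying vector space. -/
  carrier : Type v
  [addCommGroup : AddCommGroup carrier]
  [module : Module ℂ carrier]
  /-- The vertex operators. -/
  YM : V →ₗ[ℂ] (ℚ → Module.End ℂ carrier)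
  isSimple : A.IsSimpleTwistedModule g YM

attribute [instance] SimpleTwistedModule.addCommGroup SimpleTwistedModule.module

/-- Equivalence (isomorphism) of modules: a linear bijection `f` with
`f Y_M(u, z) = Y_W(u, z) f` for all `u ∈ V`. -/
def SimpleTwistedModule.Equivalent {A : VertexOperatorAlgebra V} {g : V ≃ₗ[ℂ] V}
    (M W : SimpleTwistedModule.{u, v} A g) : Prop :=
  ∃ f : M.carrier ≃ₗ[ℂ] W.carrier,
    ∀ (a : V) (n : ℚ) (w : M.carrier), f (M.YM a n w) = W.YM a n (f w)

/-- There are only finitely many simple `g`-twisted `V`-modules up to equivalence. -/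
def FinitelyManySimpleTwistedModules (A : VertexOperatorAlgebra V) (g : V ≃ₗ[ℂ] V) : Prop :=
  ∃ (k : ℕ) (W : Fin k → SimpleTwistedModule.{u, v} A g),
    ∀ N : SimpleTwistedModule.{u, v} A g, ∃ i, N.Equivalent (W i)

end VertexOperatorAlgebra

end

open scoped VertexOperator

/-! Pick from each of the finitely many simple modules one weight `c i` that occurs in it, and let
`d W` be the sum of the dimensions of `W ∩ M_(c i)`, finite since weight spaces are. Any strict
inclusion `P < Q` of submodules contains a covering pair (`StableSubspace.exists_covBy_of_lt`); its
factor is simple (`IsTwistedModule.isSimple_factor`), hence has some weight `c i`. Since L(0) is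
diagonalizable, a vector of this weight lifts to `Q` outside `P`, so `d` is strictly increasing
(`IsTwistedModule.strictMono_sum_finrank`). As `d` is bounded by its value at `M`, both chain
conditions hold, and a finite chain of covers joins 0 to `M`. -/

theorem Function.hasFiniteSupport_of_forall_ge_eq_zero {M : Type*} [Zero M] {F : ℕ → M} {B : ℕ}
    (h : ∀ i, B ≤ i → F i = 0) : F.HasFiniteSupport :=
  (Set.finite_lt_nat B).subset fun i hi => by
    by_contra hlt
    exact hi (h i (not_lt.1 hlt))

/-! ### Diagonalizable operators and intertwining maps -/

section Eigenspaces

variable {K M N : Type*} [Field K] [AddCommGroup M] [Module K M] [AddCommGroup N] [Module K N]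

theorem Module.End.map_eigenspace_le {a : Module.End K M} {b : Module.End K N} (f : M →ₗ[K] N)
    (hf : ∀ x, f (a x) = b (f x)) (μ : K) : (a.eigenspace μ).map f ≤ b.eigenspace μ := by
  rintro _ ⟨x, hx, rfl⟩
  rw [SetLike.mem_coe, Module.End.mem_eigenspace_iff] at hx
  rw [Module.End.mem_eigenspace_iff, ← hf, hx, map_smul]

theorem iSup_map_eigenspace_of_surjective {a : Module.End K M} (f : M →ₗ[K] N)
    (hs : Function.Surjective f) (ha : ⨆ μ, a.eigenspace μ = ⊤) :
    ⨆ μ, (a.eigenspace μ).map f = ⊤ := by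
  rw [← Submodule.map_iSup, ha, Submodule.map_top, LinearMap.range_eq_top.2 hs]

theorem Module.End.iSup_eigenspace_eq_top_of_surjective {a : Module.End K M} {b : Module.End K N}
    (f : M →ₗ[K] N) (hf : ∀ x, f (a x) = b (f x)) (hs : Function.Surjective f)
    (ha : ⨆ μ, a.eigenspace μ = ⊤) : ⨆ μ, b.eigenspace μ = ⊤ :=
  top_le_iff.1 <| (iSup_map_eigenspace_of_surjective f hs ha).ge.trans <|
    iSup_mono (Module.End.map_eigenspace_le f hf)

/-- A surjective intertwiner of a diagonalizable operator maps eigenspaces onto eigenspaces. -/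
theorem Module.End.map_eigenspace_eq_of_surjective {a : Module.End K M} {b : Module.End K N}
    (f : M →ₗ[K] N) (hf : ∀ x, f (a x) = b (f x)) (hs : Function.Surjective f)
    (ha : ⨆ μ, a.eigenspace μ = ⊤) (μ : K) : (a.eigenspace μ).map f = b.eigenspace μ := by
  refine le_antisymm (Module.End.map_eigenspace_le f hf μ) ?_
  -- The images of the eigenspaces span `N`; intersecting with the `μ`-eigenspace by the modular law
  -- leaves only the image of index `μ`.
  have hle : (⊤ : Submodule K N) ≤ (a.eigenspace μ).map f ⊔ ⨆ (ν) (_ : ν ≠ μ), b.eigenspace ν := by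
    rw [← iSup_map_eigenspace_of_surjective f hs ha]
    refine iSup_le fun ν => ?_
    rcases eq_or_ne ν μ with rfl | h
    · exact le_sup_left
    · exact le_sup_of_le_right <| (Module.End.map_eigenspace_le f hf ν).trans
        (le_iSup₂_of_le ν h le_rfl)
  have hdisj := b.eigenspaces_iSupIndep μ
  calc b.eigenspace μ
      = ((a.eigenspace μ).map f ⊔ ⨆ (ν) (_ : ν ≠ μ), b.eigenspace ν) ⊓ b.eigenspace μ := by
        rw [top_le_iff.1 hle, top_inf_eq]
    _ = (a.eigenspace μ).map f ⊔ (⨆ (ν) (_ : ν ≠ μ), b.eigenspace ν) ⊓ b.eigenspace μ :=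
        sup_inf_assoc_of_le _ (Module.End.map_eigenspace_le f hf μ)
    _ ≤ (a.eigenspace μ).map f := by
        rw [hdisj.symm.eq_bot, sup_bot_eq]

/-- The restriction of a diagonalizable operator to an invariant subspace is diagonalizable. -/
theorem Module.End.iSup_eigenspace_eq_top_of_injective {a : Module.End K M} {b : Module.End K N}
    (f : N →ₗ[K] M) (hf : ∀ x, f (b x) = a (f x)) (hi : Function.Injective f)
    (ha : ⨆ μ, a.eigenspace μ = ⊤) : ⨆ μ, b.eigenspace μ = ⊤ := by
  have hinv : LinearMap.range f ≤ (LinearMap.range f).comap a := by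
    rintro _ ⟨x, rfl⟩
    exact ⟨b x, hf x⟩
  -- Modulo the range of `f`, the eigencomponents of `f x` sum to zero; independence of the
  -- eigenspaces of `c` puts each component in the range.
  set q := (LinearMap.range f).mkQ
  set c : Module.End K (M ⧸ LinearMap.range f) := (LinearMap.range f).mapQ _ a hinv
  have hq : ∀ x, q (a x) = c (q x) := fun x => rfl
  refine eq_top_iff.2 fun x _ => ?_
  obtain ⟨m, hm, hsum⟩ := (Submodule.mem_iSup_iff_exists_finsupp _ _).1
    (ha.ge (Submodule.mem_top : f x ∈ ⊤))
  have hzero : ∑ μ ∈ m.support, q (m μ) = 0 := by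
    rw [← map_sum]
    exact (congrArg q hsum).trans
      ((Submodule.Quotient.mk_eq_zero _).2 (LinearMap.mem_range_self f x))
  have hcomp : ∀ μ, ∃ y, f y = m μ := by
    intro μ
    by_cases hμ : μ ∈ m.support
    · have := (iSupIndep_iff_finsetSum_eq_zero_imp_eq_zero _).1 c.eigenspaces_iSupIndep m.support
        (fun μ => q (m μ))
        (fun ν _ => Module.End.map_eigenspace_le q hq ν ⟨_, hm ν, rfl⟩) hzero μ hμ
      exact (Submodule.Quotient.mk_eq_zero _).1 this
    · exact ⟨0, by rw [map_zero, Finsupp.notMem_support_iff.1 hμ]⟩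
  choose y hy using hcomp
  have hx : x = ∑ μ ∈ m.support, y μ := hi <| by
    rw [map_sum, ← hsum]
    exact Finset.sum_congr rfl fun μ _ => (hy μ).symm
  rw [hx]
  refine Submodule.sum_mem _ fun μ _ => Submodule.mem_iSup_of_mem μ ?_
  rw [Module.End.mem_eigenspace_iff]
  refine hi ?_
  rw [hf, map_smul, hy]
  exact Module.End.mem_eigenspace_iff.1 (hm μ)

end Eigenspaces

/-! ### Covers in the lattice of stable subspaces -/

section StableSubspaces

variable {V : Type*} [AddCommGroup V] [Module ℂ V] {M : Type*} [AddCommGroup M] [Module ℂ M]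

/-- The stable subspaces of `M`, ordered by inclusion. -/
abbrev StableSubspace (YM : V →ₗ[ℂ] (ℚ → Module.End ℂ M)) : Type _ :=
  {W : Submodule ℂ M // IsStableUnder YM W}

theorem IsStableUnder.sInf {YM : V →ₗ[ℂ] (ℚ → Module.End ℂ M)} {S : Set (Submodule ℂ M)}
    (hS : ∀ W ∈ S, IsStableUnder YM W) : IsStableUnder YM (sInf S) := by
  intro v n w hw
  rw [Submodule.mem_sInf] at hw ⊢
  exact fun W hW => hS W hW v n w (hw W hW)

theorem IsStableUnder.sSup_of_directedOn {YM : V →ₗ[ℂ] (ℚ → Module.End ℂ M)}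
    {S : Set (Submodule ℂ M)} (hne : S.Nonempty) (hdir : DirectedOn (· ≤ ·) S)
    (hS : ∀ W ∈ S, IsStableUnder YM W) : IsStableUnder YM (sSup S) := by
  intro v n w hw
  rw [Submodule.mem_sSup_of_directed hne hdir] at hw ⊢
  obtain ⟨W, hW, hw⟩ := hw
  exact ⟨W, hW, hS W hW v n w hw⟩

/-- The lattice of stable subspaces is weakly atomic. -/
theorem StableSubspace.exists_covBy_of_lt {YM : V →ₗ[ℂ] (ℚ → Module.End ℂ M)}
    {P Q : StableSubspace YM} (h : P < Q) : ∃ P' Q', P ≤ P' ∧ P' ⋖ Q' ∧ Q' ≤ Q := by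
  obtain ⟨q, hqQ, hqP⟩ := SetLike.exists_of_lt (show P.1 < Q.1 from h)
  -- `P'` is maximal among stable subspaces between `P` and `Q` that avoid `q`.
  obtain ⟨P', hPP', hmax⟩ := zorn_le_nonempty₀
    {X : Submodule ℂ M | IsStableUnder YM X ∧ X ≤ Q.1 ∧ q ∉ X}
    (fun c hc hchain y hy => ⟨sSup c, ⟨IsStableUnder.sSup_of_directedOn ⟨y, hy⟩ hchain.directedOn
        fun W hW => (hc hW).1, sSup_le fun W hW => (hc hW).2.1, fun hq => by
          obtain ⟨W, hW, hqW⟩ := (Submodule.mem_sSup_of_directed ⟨y, hy⟩ hchain.directedOn).1 hq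
          exact (hc hW).2.2 hqW⟩, fun z hz => le_sSup hz⟩)
    P.1 ⟨P.2, h.le, hqP⟩
  obtain ⟨hP'stab, hP'Q, hqP'⟩ := hmax.prop
  -- `sInf S` is generated by `P'` and `q`: a stable subspace strictly in between cannot contain `q`
  -- by minimality, nor avoid it by maximality of `P'`.
  let S : Set (Submodule ℂ M) := {X | IsStableUnder YM X ∧ P' ≤ X ∧ q ∈ X}
  have hstab : IsStableUnder YM (sInf S) := IsStableUnder.sInf fun W hW => hW.1
  have hqS : q ∈ sInf S := Submodule.mem_sInf.2 fun W hW => hW.2.2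
  have hSQ : sInf S ≤ Q.1 := sInf_le ⟨Q.2, hP'Q, hqQ⟩
  have hP'S : P' ≤ sInf S := le_sInf fun W hW => hW.2.1
  refine ⟨⟨P', hP'stab⟩, ⟨sInf S, hstab⟩, hPP', ⟨?_, ?_⟩, hSQ⟩
  · exact lt_of_le_of_ne hP'S fun heq => hqP' ((congrArg Subtype.val heq).ge hqS)
  · rintro ⟨X, hX⟩ (h₁ : P' < X) (h₂ : X < sInf S)
    by_cases hqX : q ∈ X
    · exact h₂.not_ge (sInf_le ⟨hX, h₁.le, hqX⟩)
    · exact h₁.not_ge (hmax.le_of_ge ⟨hX, h₂.le.trans hSQ, hqX⟩ h₁.le)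

end StableSubspaces

/-! ### Submodules, quotients and factors of twisted modules -/

namespace VertexOperatorAlgebra

variable {V : Type*} [AddCommGroup V] [Module ℂ V] {A : VertexOperatorAlgebra V} {g : V ≃ₗ[ℂ] V}
variable {M N : Type*} [AddCommGroup M] [Module ℂ M] [AddCommGroup N] [Module ℂ N]
variable {YM : V →ₗ[ℂ] (ℚ → Module.End ℂ M)} {YN : V →ₗ[ℂ] (ℚ → Module.End ℂ N)}

theorem exists_nat_forall_mode_add_eq_zero
    (htr : ∀ (v : V) (w : M), ∃ B : ℚ, ∀ l : ℚ, B ≤ l → YM v l w = 0) (v : V) (w : M) (n : ℚ) :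
    ∃ B : ℕ, ∀ i : ℕ, B ≤ i → YM v (n + i) w = 0 := by
  obtain ⟨B, hB⟩ := htr v w
  obtain ⟨k, hk⟩ := exists_nat_ge (B - n)
  refine ⟨k, fun i hi => hB _ ?_⟩
  have : (k : ℚ) ≤ i := by exact_mod_cast hi
  linarith

theorem exists_nat_forall_ncoeff_add_eq_zero (Y : VertexOperator ℂ V) (v : V) (l : ℤ) :
    ∃ B : ℕ, ∀ i : ℕ, B ≤ i → (Y[[l + i]]) v = 0 := by
  refine ⟨(-l - HahnSeries.order ((HahnModule.of ℂ).symm (Y v))).toNat, fun i hi => ?_⟩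
  refine VertexOperator.ncoeff_eq_zero_of_lt_order _ _ _ ?_
  have := Int.self_le_toNat (-l - HahnSeries.order ((HahnModule.of ℂ).symm (Y v)))
  lia

/-- Both sides of the twisted Jacobi identity commute with intertwining maps. -/
theorem map_jacobi_sums (f : M →ₗ[ℂ] N) (hf : ∀ v n w, f (YM v n w) = YN v n (f w))
    (htr : ∀ (v : V) (w : M), ∃ B : ℚ, ∀ l : ℚ, B ≤ l → YM v l w = 0)
    (u v : V) (w : M) (l : ℤ) (m n : ℚ) :
    f ((∑ᶠ i : ℕ, ((-1 : ℂ) ^ i * (Ring.choose l i : ℤ)) •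
        YM u (m + l - i) (YM v (n + i) w)) -
      (∑ᶠ i : ℕ, ((-1 : ℂ) ^ (l + i) * (Ring.choose l i : ℤ)) •
        YM v (n + l - i) (YM u (m + i) w))) =
    (∑ᶠ i : ℕ, ((-1 : ℂ) ^ i * (Ring.choose l i : ℤ)) •
        YN u (m + l - i) (YN v (n + i) (f w))) -
      (∑ᶠ i : ℕ, ((-1 : ℂ) ^ (l + i) * (Ring.choose l i : ℤ)) •
        YN v (n + l - i) (YN u (m + i) (f w))) ∧
    f (∑ᶠ i : ℕ, ((Ring.choose m i : ℚ) : ℂ) • YM (((A.Y u)[[l + i]]) v) (m + n - i) w) =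
    ∑ᶠ i : ℕ, ((Ring.choose m i : ℚ) : ℂ) • YN (((A.Y u)[[l + i]]) v) (m + n - i) (f w) := by
  obtain ⟨B₁, h₁⟩ := exists_nat_forall_mode_add_eq_zero htr v w n
  obtain ⟨B₂, h₂⟩ := exists_nat_forall_mode_add_eq_zero htr u w m
  obtain ⟨B₃, h₃⟩ := exists_nat_forall_ncoeff_add_eq_zero (A.Y u) v l
  -- `f` passes through a `finsum` only if the support is finite, which truncation in `M` and in `V`
  -- provides.
  rw [map_sub, map_finsum f, map_finsum f, map_finsum f]
  · simp only [map_smul, hf, and_self]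
  · exact Function.hasFiniteSupport_of_forall_ge_eq_zero (B := B₃) fun i hi => by simp [h₃ i hi]
  · exact Function.hasFiniteSupport_of_forall_ge_eq_zero (B := B₂) fun i hi => by simp [h₂ i hi]
  · exact Function.hasFiniteSupport_of_forall_ge_eq_zero (B := B₁) fun i hi => by simp [h₁ i hi]

theorem IsTwistedModule.iSup_weightSpace (hM : A.IsTwistedModule g YM) :
    ⨆ a, A.weightSpace YM a = ⊤ :=
  hM.isInternal.submodule_iSup_eq_top

/-- Eigenspaces are always independent, so only spanning has to be checked. -/
theorem isInternal_weightSpace (h : ⨆ a, A.weightSpace YM a = ⊤) :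
    DirectSum.IsInternal (A.weightSpace YM) :=
  DirectSum.isInternal_submodule_of_iSupIndep_of_iSup_eq_top
    (Module.End.eigenspaces_iSupIndep (YM A.ω 1)) h

theorem IsTwistedModule.map_weightSpace (hM : A.IsTwistedModule g YM) (f : M →ₗ[ℂ] N)
    (hf : ∀ v n w, f (YM v n w) = YN v n (f w)) (hs : Function.Surjective f) (a : ℂ) :
    (A.weightSpace YM a).map f = A.weightSpace YN a :=
  Module.End.map_eigenspace_eq_of_surjective f (hf A.ω 1) hs hM.iSup_weightSpace a

/-- Quotients of twisted modules are twisted modules. -/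
theorem IsTwistedModule.of_surjective (hM : A.IsTwistedModule g YM) (f : M →ₗ[ℂ] N)
    (hf : ∀ v n w, f (YM v n w) = YN v n (f w)) (hs : Function.Surjective f) :
    A.IsTwistedModule g YN where
  mode_eq_zero r hr u hu n hn := by
    ext y
    obtain ⟨w, rfl⟩ := hs y
    rw [← hf, hM.mode_eq_zero r hr u hu n hn]
    simp
  truncation v y := by
    obtain ⟨w, rfl⟩ := hs y
    obtain ⟨B, hB⟩ := hM.truncation v w
    exact ⟨B, fun l hl => by rw [← hf, hB l hl, map_zero]⟩
  vacuum n := by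
    ext y
    obtain ⟨w, rfl⟩ := hs y
    rw [← hf, hM.vacuum]
    split_ifs <;> simp
  jacobi r hr u hu v y l m n hm := by
    obtain ⟨w, rfl⟩ := hs y
    obtain ⟨h₁, h₂⟩ := map_jacobi_sums (A := A) f hf hM.truncation u v w l m n
    rw [← h₁, ← h₂, hM.jacobi r hr u hu v w l m n hm]
  isInternal := isInternal_weightSpace <|
    Module.End.iSup_eigenspace_eq_top_of_surjective f (hf A.ω 1) hs hM.iSup_weightSpace
  finite_weightSpace a := by
    have := hM.finite_weightSpace a
    rw [← hM.map_weightSpace f hf hs]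
    infer_instance
  bounded_below a := by
    obtain ⟨B, hB⟩ := hM.bounded_below a
    exact ⟨B, fun n hn => by rw [← hM.map_weightSpace f hf hs, hB n hn, Submodule.map_bot]⟩

/-- Submodules of twisted modules are twisted modules. -/
theorem IsTwistedModule.of_injective (hM : A.IsTwistedModule g YM) (f : N →ₗ[ℂ] M)
    (hf : ∀ v n w, f (YN v n w) = YM v n (f w)) (hi : Function.Injective f) :
    A.IsTwistedModule g YN := by
  have htr : ∀ (v : V) (w : N), ∃ B : ℚ, ∀ l : ℚ, B ≤ l → YN v l w = 0 := fun v w => by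
    obtain ⟨B, hB⟩ := hM.truncation v (f w)
    exact ⟨B, fun l hl => hi (by rw [hf, hB l hl, map_zero])⟩
  have hle : ∀ a, (A.weightSpace YN a).map f ≤ A.weightSpace YM a :=
    Module.End.map_eigenspace_le f (hf A.ω 1)
  exact
  { mode_eq_zero := fun r hr u hu n hn => by
      ext w
      refine hi ?_
      rw [hf, hM.mode_eq_zero r hr u hu n hn]
      simp
    truncation := htr
    vacuum := fun n => by
      ext w
      refine hi ?_
      rw [hf, hM.vacuum]
      split_ifs <;> simp
    jacobi := fun r hr u hu v w l m n hm => by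
      obtain ⟨h₁, h₂⟩ := map_jacobi_sums (A := A) f hf htr u v w l m n
      refine hi ?_
      rw [h₁, h₂, hM.jacobi r hr u hu v (f w) l m n hm]
    isInternal := isInternal_weightSpace <|
      Module.End.iSup_eigenspace_eq_top_of_injective f (hf A.ω 1) hi hM.iSup_weightSpace
    finite_weightSpace := fun a => by
      have := hM.finite_weightSpace a
      have : FiniteDimensional ℂ ((A.weightSpace YN a).map f) :=
        Submodule.finiteDimensional_of_le (hle a)
      exact Module.Finite.equiv (Submodule.equivMapOfInjective f hi _).symm
    bounded_below := fun a => by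
      obtain ⟨B, hB⟩ := hM.bounded_below a
      refine ⟨B, fun n hn => ?_⟩
      have := hle ((n : ℂ) / orderOf g + a)
      rw [hB n hn, le_bot_iff] at this
      exact Submodule.map_injective_of_injective hi (this.trans (Submodule.map_bot f).symm) }

theorem IsTwistedModule.restrict (hM : A.IsTwistedModule g YM) {Q : Submodule ℂ M}
    (hQ : IsStableUnder YM Q) : A.IsTwistedModule g (restrictOperators YM Q hQ) :=
  hM.of_injective Q.subtype (fun _ _ _ => rfl) Q.injective_subtype

theorem IsTwistedModule.factor (hM : A.IsTwistedModule g YM) {P Q : Submodule ℂ M}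
    (hP : IsStableUnder YM P) (hQ : IsStableUnder YM Q) :
    A.IsTwistedModule g (factorOperators YM P Q hP hQ) :=
  (hM.restrict hQ).of_surjective (P.submoduleOf Q).mkQ (fun _ _ _ => rfl)
    (Submodule.mkQ_surjective _)

/-- The factor of a covering pair of stable subspaces is simple. -/
theorem IsTwistedModule.isSimple_factor (hM : A.IsTwistedModule g YM) {P Q : StableSubspace YM}
    (h : P ⋖ Q) : A.IsSimpleTwistedModule g (factorOperators YM P.1 Q.1 P.2 Q.2) where
  toIsTwistedModule := hM.factor P.2 Q.2
  nontrivial := by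
    rw [Submodule.Quotient.nontrivial_iff, Ne, Submodule.submoduleOf_eq_top]
    exact h.lt.not_ge
  eq_bot_or_eq_top W hW := by
    set q := (P.1.submoduleOf Q.1).mkQ with hq
    have hqs : Function.Surjective q := Submodule.mkQ_surjective _
    have hmem : ∀ x : Q.1, (x : M) ∈ (W.comap q).map Q.1.subtype ↔ q x ∈ W := fun x => by
      simp [Submodule.mem_map]
    -- The preimage of `W` in `Q`, seen inside `M`; it lies between `P` and `Q`, so it is one of
    -- them.
    let X : StableSubspace YM := ⟨(W.comap q).map Q.1.subtype, by
      rintro v n _ ⟨x, hx, rfl⟩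
      exact ⟨⟨YM v n x, Q.2 v n x x.2⟩, hW v n _ hx, rfl⟩⟩
    have hPX : P ≤ X := fun x hx => (hmem ⟨x, h.le hx⟩).2 <| by
      rw [hq, Submodule.mkQ_apply, (Submodule.Quotient.mk_eq_zero _).2 (by exact hx)]
      exact W.zero_mem
    have hXQ : X ≤ Q := by
      rintro _ ⟨x, -, rfl⟩
      exact x.2
    rcases h.eq_or_eq hPX hXQ with hX | hX
    · refine Or.inl (eq_bot_iff.2 fun y hy => ?_)
      obtain ⟨x, rfl⟩ := hqs y
      have : (x : M) ∈ X.1 := (hmem x).2 hy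
      rw [hX] at this
      exact (Submodule.Quotient.mk_eq_zero _).2 this
    · refine Or.inr (eq_top_iff.2 fun y _ => ?_)
      obtain ⟨x, rfl⟩ := hqs y
      exact (hmem x).1 (show (x : M) ∈ X.1 by rw [hX]; exact x.2)

/-! ### Counting weight multiplicities -/

theorem IsTwistedModule.exists_weightSpace_ne_bot [Nontrivial M] (hM : A.IsTwistedModule g YM) :
    ∃ a, A.weightSpace YM a ≠ ⊥ := by
  by_contra! h
  have := hM.iSup_weightSpace
  simp only [h, iSup_bot] at this
  exact bot_ne_top this

/-- A vector of weight `a` in a factor `Q / P` lifts to a vector of weight `a`. -/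
theorem IsTwistedModule.exists_mem_weightSpace_notMem (hM : A.IsTwistedModule g YM)
    {P Q : Submodule ℂ M} (hP : IsStableUnder YM P) (hQ : IsStableUnder YM Q) {a : ℂ}
    (ha : A.weightSpace (factorOperators YM P Q hP hQ) a ≠ ⊥) :
    ∃ x ∈ A.weightSpace YM a, x ∈ Q ∧ x ∉ P := by
  obtain ⟨y, hy, hy0⟩ := Submodule.exists_mem_ne_zero_of_ne_bot ha
  rw [← (hM.restrict hQ).map_weightSpace (P.submoduleOf Q).mkQ (fun _ _ _ => rfl)
    (Submodule.mkQ_surjective _)] at hy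
  obtain ⟨x, hx, rfl⟩ := hy
  refine ⟨x, ?_, x.2, fun hxP => hy0 ((Submodule.Quotient.mk_eq_zero _).2 hxP)⟩
  exact Module.End.map_eigenspace_le Q.subtype (fun _ => rfl) a ⟨x, hx, rfl⟩

/-- If finitely many weights meet every simple twisted module, then the total multiplicity of
these weights is strictly monotone on stable subspaces. -/
theorem IsTwistedModule.strictMono_sum_finrank (hM : A.IsTwistedModule g YM) {ι : Type*}
    [Fintype ι] (c : ι → ℂ)
    (hc : ∀ P Q : StableSubspace YM, P ⋖ Q →
      ∃ i, A.weightSpace (factorOperators YM P.1 Q.1 P.2 Q.2) (c i) ≠ ⊥) :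
    StrictMono fun W : StableSubspace YM =>
      ∑ i, Module.finrank ℂ (W.1 ⊓ A.weightSpace YM (c i) : Submodule ℂ M) := by
  intro P Q h
  have hfin : ∀ (W : Submodule ℂ M) i,
      FiniteDimensional ℂ (W ⊓ A.weightSpace YM (c i) : Submodule ℂ M) := fun W i =>
    have := hM.finite_weightSpace (c i)
    Submodule.finiteDimensional_of_le inf_le_right
  obtain ⟨P', Q', hPP', hcov, hQQ'⟩ := StableSubspace.exists_covBy_of_lt h
  obtain ⟨i, hi⟩ := hc P' Q' hcov
  obtain ⟨x, hxa, hxQ, hxP⟩ := hM.exists_mem_weightSpace_notMem P'.2 Q'.2 hi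
  refine Finset.sum_lt_sum (fun j _ => ?_) ⟨i, Finset.mem_univ i, ?_⟩
  · have := hfin Q.1 j
    exact Submodule.finrank_mono (inf_le_inf_right _ h.le)
  · have := hfin Q.1 i
    refine Submodule.finrank_lt_finrank_of_lt
      -- Equal intersections would force `x` into `P ≤ P'`.
      (lt_of_le_of_ne (inf_le_inf_right _ h.le) fun heq => hxP (hPP' ?_))
    exact (heq.ge (Submodule.mem_inf.2 ⟨hQQ' hxQ, hxa⟩)).1

end VertexOperatorAlgebra

open VertexOperatorAlgebra in
theorem proposition9 {V : Type u} [AddCommGroup V] [Module ℂ V]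
    (A : VertexOperatorAlgebra V) (g : V ≃ₗ[ℂ] V) (hg : A.IsAutomorphism g)
    (hT : IsOfFinOrder g)
    (hfin : VertexOperatorAlgebra.FinitelyManySimpleTwistedModules.{u, v} A g)
    {M : Type v} [AddCommGroup M] [Module ℂ M] (YM : V →ₗ[ℂ] (ℚ → Module.End ℂ M))
    (hM : A.IsTwistedModule g YM) :
    A.HasFiniteCompositionSeries g YM := by
  obtain ⟨k, S, hS⟩ := hfin
  have hweight : ∀ i, ∃ a, A.weightSpace (S i).YM a ≠ ⊥ := fun i =>
    have := (S i).isSimple.nontrivial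
    (S i).isSimple.toIsTwistedModule.exists_weightSpace_ne_bot
  choose c hc using hweight
  have hmono := hM.strictMono_sum_finrank c fun P Q hcov => by
    obtain ⟨i, f, hf⟩ := hS ⟨_, _, hM.isSimple_factor hcov⟩
    refine ⟨i, fun hbot => hc i ?_⟩
    rw [← (hM.factor P.2 Q.2).map_weightSpace (f : _ →ₗ[ℂ] (S i).carrier) hf f.surjective, hbot,
      Submodule.map_bot]
  set d := fun W : StableSubspace YM =>
      ∑ i, Module.finrank ℂ (W.1 ⊓ A.weightSpace YM (c i) : Submodule ℂ M)
  let bot : StableSubspace YM := ⟨⊥, fun v n w hw => by simp_all⟩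
  let top : StableSubspace YM := ⟨⊤, fun _ _ _ _ => Submodule.mem_top⟩
  have hle : ∀ W, d W ≤ d top := fun W => hmono.monotone (show W.1 ≤ ⊤ from le_top)
  have : WellFoundedLT (StableSubspace YM) := hmono.wellFoundedLT
  have : WellFoundedGT (StableSubspace YM) :=
    -- The codimension count strictly decreases; `hle` keeps the natural subtraction from
    -- truncating.
    StrictAnti.wellFoundedGT (f := fun W => d top - d W) fun P Q h => by
      have h₁ : d P < d Q := hmono h
      have h₂ := hle Q
      show d top - d Q < d top - d P
      lia
  obtain ⟨F, hF0, n, hFn, hF⟩ := exists_covBy_seq_of_wellFoundedLT_wellFoundedGT_of_le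
    (show bot ≤ top from (bot_le : (⊥ : Submodule ℂ M) ≤ ⊤))
  exact ⟨n, fun i => (F i).1, fun i => (F i).2, congrArg Subtype.val hF0, congrArg Subtype.val hFn,
    fun i => ⟨(hF i i.2).le, hM.isSimple_factor (hF i i.2)⟩⟩
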